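/- \textbf{Definitions.} A randomized mechanism $\mathcal M:\mathbb R^n\to\mathcal Y$ (a Markov kernel into a measurable space) is $\varepsilon\ell_1$-private if $\Pr[\mathcal M(D)\in S]\le e^{\varepsilon\|D-D'\|_1}\Pr[\mathcal M(D')\in S]$ for all $D,D'\in\mathbb R^n$ and all measurable $S\subseteq\mathcal Y$. For $\rho\in[0,1]$, a matrix $\Sigma_\rho\in\mathbb R^{n\times n}$ is a limited covariance matrix if it is symmetric positive definite and there is $\sigma^2>0$ with $(\Sigma_\rho)_{ii}=\sigma^2$ for all $i$ and $|(\Sigma_\rho)_{ij}|\le\rho\sigma^2$ for all $i\ne j$. A random vector $\mathbf X=(X_1,\dots,X_n)$ has at most $m$ correlated records if $\{1,\dots,n\}$ is a disjoint union of sets $C_1,\dots,C_r$ with $|C_l|\le m$ such that, for each $l$, $(X_j)_{j\in C_l}$ is independent of $(X_j)_{j\notin C_l}$. Let $Y$ be the output of $\mathcal M$ on input $\mathbf X$, where $\mathbf X$ has a density, and let $p_Y(\cdot\mid \mathbf X_K=\mathbf x_K,X_i=x)$ be the density of the conditional law of $Y$, obtained by averaging the output law of $\mathcal M$ over the conditional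 density of the remaining records given $\mathbf X_K=\mathbf x_K$, $X_i=x$. The target-dependent Bayesian leakage is $$\mathrm{BDPL}(x,x')=\sup_{i\in[n],\,K\subseteq[n]\setminus\{i\}}\ \sup_{\mathbf x_K,\,s}\ \ln\frac{p_Y(s\mid \mathbf X_K=\mathbf x_K,X_i=x)}{p_Y(s\mid \mathbf X_K=\mathbf x_K,X_i=x')},$$ where, for each $i,K,\mathbf x_K$, the densities are taken with respect to a common dominating measure and the supremum over $s$ is the essential supremum. \textbf{Theorem.} Let $\varepsilon>0$ and let $\mathcal M:\mathbb R^n\to\mathcal Y$ be an $\varepsilon\ell_1$-private mechanism whose input is drawn from a multivariate Gaussian distribution $\mathcal N(\mu,\Sigma_\rho)$ with mean $\mu\in\mathbb R^n$ and limited covariance matrix $\Sigma_\rho$, $\rho\in[0,1]$, having at most $m\le n$ correlated records, and suppose $\rho(m-2)<1$. Then for all $x,x'\in\mathbb R$ $$\mathrm{BDPL}(x,x')\le\left(\frac{m^2}{4\left(\frac1\rho-m+2\right)}+1\right)\varepsilon\,|x'-x|,$$ where for $\rho=0$ the fraction is read as $0$, i.e. $\mathrm{BDPL}(x,x')\le\varepsilon|x'-x|$.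 -/

import Mathlib

open MeasureTheory ProbabilityTheory

noncomputable section

namespace BayesianPrivacy

/-- Density of the multivariate Gaussian distribution `N(μ, Σ)` on `ℝⁿ` with respect to
Lebesgue measure (for `Σ` symmetric and positive definite). -/
def gaussianDensity {n : ℕ} (μ : Fin n → ℝ) (Sig : Matrix (Fin n) (Fin n) ℝ)
    (x : Fin n → ℝ) : ℝ :=
  1 / Real.sqrt ((2 * Real.pi) ^ n * Sig.det) *
    Real.exp (-(1 / 2) * ((x - μ) ⬝ᵥ (Matrix.mulVec Sig⁻¹ (x - μ))))

/-- The distribution on `ℝⁿ` with Lebesgue density `p`. -/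
def lawOfDensity {n : ℕ} (p : (Fin n → ℝ) → ℝ) : Measure (Fin n → ℝ) :=
  (volume : Measure (Fin n → ℝ)).withDensity (fun x => ENNReal.ofReal (p x))

/-- `Σ` is a limited covariance matrix for the correlation bound `ρ`. -/
structure IsLimitedCovariance {n : ℕ} (ρ : ℝ) (Sig : Matrix (Fin n) (Fin n) ℝ) : Prop where
  posDef : Sig.PosDef
  bound : ∃ σ2 : ℝ, 0 < σ2 ∧ (∀ i, Sig i i = σ2) ∧ ∀ i j, i ≠ j → |Sig i j| ≤ ρ * σ2

/-- A random vector with law `P` has at most `m` correlated random variables: the indices split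
into disjoint groups of size at most `m`, and the variables of each group are independent of the
remaining variables. -/
def HasAtMostCorrelated {n : ℕ} (P : Measure (Fin n → ℝ)) (m : ℕ) : Prop :=
  ∃ (r : ℕ) (C : Fin r → Finset (Fin n)),
    (∀ l l', l ≠ l' → Disjoint (C l) (C l')) ∧
    (∀ j, ∃ l, j ∈ C l) ∧
    ∀ l, (C l).card ≤ m ∧
      IndepFun (fun (x : Fin n → ℝ) (j : {j // j ∈ C l}) => x j)
        (fun (x : Fin n → ℝ) (j : {j // j ∉ C l}) => x j) P

/-- A randomized mechanism (a kernel from databases to outputs) is `d`-private. -/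
def IsMetricPrivate {X Y : Type*} [MeasurableSpace X] [MeasurableSpace Y]
    (d : X → X → ℝ) (M : Kernel X Y) : Prop :=
  ∀ (D D' : X) (S : Set Y), MeasurableSet S →
    M D S ≤ ENNReal.ofReal (Real.exp (d D D')) * M D' S

/-- The `ℓ₁`-distance on `ℝⁿ`. -/
def l1Dist {n : ℕ} (D D' : Fin n → ℝ) : ℝ := ∑ i, |D i - D' i|

/-- The database whose known records are `xK`, whose target record `i` is `x` and whose unknown
records are `xU`. -/
def database {n : ℕ} (K : Finset (Fin n)) (i : Fin n) (xK : {j // j ∈ K} → ℝ) (x : ℝ)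
    (xU : {j // j ≠ i ∧ j ∉ K} → ℝ) : Fin n → ℝ := fun j =>
  if hi : j = i then x else if hK : j ∈ K then xK ⟨j, hK⟩ else xU ⟨j, hi, hK⟩

/-- Conditional density of the unknown records given `X_K = xK` and `X_i = x`, for an input
vector with joint density `p`. -/
def condDensity {n : ℕ} (p : (Fin n → ℝ) → ℝ) (K : Finset (Fin n)) (i : Fin n)
    (xK : {j // j ∈ K} → ℝ) (x : ℝ) (xU : {j // j ≠ i ∧ j ∉ K} → ℝ) : ℝ :=
  p (database K i xK x xU) / ∫ v, p (database K i xK x v)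

/-- Conditional distribution of the output `Y` given `X_K = xK` and `X_i = x`: the output
distribution of the mechanism averaged over the conditional density of the unknown records. -/
def condOutput {n : ℕ} {Y : Type*} [MeasurableSpace Y] (p : (Fin n → ℝ) → ℝ)
    (M : Kernel (Fin n → ℝ) Y) (K : Finset (Fin n)) (i : Fin n)
    (xK : {j // j ∈ K} → ℝ) (x : ℝ) : Measure Y :=
  ((volume : Measure ({j // j ≠ i ∧ j ∉ K} → ℝ)).withDensity
    (fun xU => ENNReal.ofReal (condDensity p K i xK x xU))).bind
      (fun xU => M (database K i xK x xU))

/-- Supremum over outputs `s` of `ln (p₁(s) / p₂(s))`, where `p₁, p₂` are the densities of `P₁, P₂`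
with respect to the common dominating measure `P₁ + P₂`. Densities are defined only up to null
sets, so the supremum is the essential one; its value is the same for every σ-finite dominating
measure. Here `ln (a / 0) = ⊤` for `a > 0`, and points with `p₁(s) = 0` contribute `⊥`. -/
def maxLogRatio {Y : Type*} [MeasurableSpace Y] (P₁ P₂ : Measure Y) : EReal :=
  essSup (fun s => ENNReal.log (P₁.rnDeriv (P₁ + P₂) s / P₂.rnDeriv (P₁ + P₂) s)) (P₁ + P₂)

/-- Adversary-specific target dependent leakage `BDPL_{(K,i)}(x, x')`. -/
def adversaryLeakage {n : ℕ} {Y : Type*} [MeasurableSpace Y] (p : (Fin n → ℝ) → ℝ)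
    (M : Kernel (Fin n → ℝ) Y) (K : Finset (Fin n)) (i : Fin n) (x x' : ℝ) : EReal :=
  ⨆ xK : {j // j ∈ K} → ℝ, maxLogRatio (condOutput p M K i xK x) (condOutput p M K i xK x')

/-- Target dependent leakage `BDPL(x, x')`: the supremum over all adversaries `(K, i)`,
`K ⊆ [n] \ {i}`. -/
def targetLeakage {n : ℕ} {Y : Type*} [MeasurableSpace Y] (p : (Fin n → ℝ) → ℝ)
    (M : Kernel (Fin n → ℝ) Y) (x x' : ℝ) : EReal :=
  ⨆ (i : Fin n) (K : Finset (Fin n)) (_ : i ∉ K), adversaryLeakage p M K i x x'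

end BayesianPrivacy

end

/-!
For a Gaussian vector, conditioning on known records `X_K = x_K` and a target value `X_i = x` gives
unknown records whose conditional covariance does not depend on `x` and whose conditional mean is
affine in `x`. The conditional laws at `x` and `x'` are therefore translates of one another, and the
databases at `x` and `x'` can be coupled so that they differ by the deterministic vector
`(x' - x) • w`, where `w i = 1`, `w` vanishes on `K`, and the other entries of `w` are regression
coefficients. Privacy of the mechanism gives a leakage of at most `ε * |x' - x| * ‖w‖₁`
(`condOutput_le_of_shift`).

The vector `w` is written as `Σ z` with `z` supported on known and target records. Translating the
Gaussian density by a multiple of `Σ z` multiplies it by a factor depending only on the coordinates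
where `z` is nonzero (`gaussianDensity_add_mulVec`), so this factor is constant in the unknown
records and cancels in the conditional density; no explicit conditional Gaussian is needed.

It remains to bound `‖w‖₁`. Let `C` be the block of correlated records containing `i`, and
`T = ({i} ∪ K) ∩ C`. Independence of `C` from its complement makes the covariances between them
vanish (`covariance_eq_zero_of_indepFun`), so `z` may be taken supported on `T` with
`Σ_TT z = e_i`, and `w` vanishes outside `C`. Diagonal dominance of `Σ_TT` gives
`σ² ‖z‖₁ ≤ 1 / (1 - ρ (|T| - 1))` (`sum_abs_mul_le_one`). Each of the `|C| - |T| ≤ m - |T|` unknown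
entries is at most `ρ σ² ‖z‖₁` in absolute value. If there is such an entry then `|T| ≤ m - 1`, and
`m - |T| ≤ m - 1 ≤ m² / 4` yields the bound (`sum_abs_mulVec_le`).
-/

open Filter Topology

namespace BayesianPrivacy

/-! ### Essential suprema of log-likelihood ratios -/

theorem maxLogRatio_le_of_le_smul {Y : Type*} [MeasurableSpace Y] {P₁ P₂ : Measure Y}
    [IsFiniteMeasure P₁] [IsFiniteMeasure P₂] {c : ℝ}
    (h : ∀ S, MeasurableSet S → P₁ S ≤ ENNReal.ofReal (Real.exp c) * P₂ S) :
    maxLogRatio P₁ P₂ ≤ (c : EReal) := by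
  have h₁ : P₁ ≪ P₁ + P₂ := Measure.absolutelyContinuous_of_le (Measure.le_add_right le_rfl)
  have h₂ : P₂ ≪ P₁ + P₂ := Measure.absolutelyContinuous_of_le (Measure.le_add_left le_rfl)
  have key : P₁.rnDeriv (P₁ + P₂) ≤ᵐ[P₁ + P₂]
      fun s => ENNReal.ofReal (Real.exp c) * P₂.rnDeriv (P₁ + P₂) s := by
    refine ae_le_of_forall_setLIntegral_le_of_sigmaFinite (Measure.measurable_rnDeriv _ _) ?_
    intro S hS _
    rw [lintegral_const_mul _ (Measure.measurable_rnDeriv _ _),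
      Measure.setLIntegral_rnDeriv h₁, Measure.setLIntegral_rnDeriv h₂]
    exact h S hS
  refine essSup_le_of_ae_le _ ?_
  filter_upwards [key] with s hs
  calc ENNReal.log _ ≤ ENNReal.log (ENNReal.ofReal (Real.exp c)) :=
        ENNReal.log_le_log (ENNReal.div_le_of_le_mul hs)
    _ = (c : EReal) := by rw [ENNReal.log_ofReal_of_pos (Real.exp_pos _), Real.log_exp]

/-! ### Conditional output laws and translations -/

theorem measurable_database {n : ℕ} (K : Finset (Fin n)) (i : Fin n)
    (xK : {j // j ∈ K} → ℝ) (x : ℝ) : Measurable (database K i xK x) := by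
  refine measurable_pi_lambda _ fun j => ?_
  unfold database
  split_ifs <;> fun_prop

/-- Integrability is not needed: if the normalizing integral diverges, its value is `0` and so is the
conditional density. -/
theorem lintegral_condDensity_le_one {n : ℕ} {p : (Fin n → ℝ) → ℝ} (hp : ∀ y, 0 ≤ p y)
    (K : Finset (Fin n)) (i : Fin n) (xK : {j // j ∈ K} → ℝ) (x : ℝ) :
    ∫⁻ u, ENNReal.ofReal (condDensity p K i xK x u) ≤ 1 := by
  unfold condDensity
  by_cases hint : Integrable (fun u => p (database K i xK x u))
  · rw [← ofReal_integral_eq_lintegral_ofReal (hint.div_const _)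
      (ae_of_all _ fun u => div_nonneg (hp _) (integral_nonneg fun v => hp _)), integral_div]
    simpa using div_self_le_one _
  · simp [integral_undef hint]

theorem condOutput_apply {n : ℕ} {Y : Type*} [MeasurableSpace Y] {p : (Fin n → ℝ) → ℝ}
    (hp : Measurable p) (M : Kernel (Fin n → ℝ) Y) (K : Finset (Fin n)) (i : Fin n)
    (xK : {j // j ∈ K} → ℝ) (x : ℝ) {S : Set Y} (hS : MeasurableSet S) :
    condOutput p M K i xK x S = ∫⁻ u, ENNReal.ofReal (condDensity p K i xK x u) *
      M (database K i xK x u) S := by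
  have hdb := measurable_database K i xK x
  have hc : Measurable (condDensity p K i xK x) := (hp.comp hdb).div_const _
  have hMS : Measurable fun u => M (database K i xK x u) S := (M.measurable_coe hS).comp hdb
  rw [condOutput, Measure.bind_apply (f := fun u => M (database K i xK x u)) hS
    (M.measurable.comp hdb).aemeasurable, lintegral_withDensity_eq_lintegral_mul _ hc.ennreal_ofReal
      hMS]
  rfl

theorem isFiniteMeasure_condOutput {n : ℕ} {Y : Type*} [MeasurableSpace Y]
    {p : (Fin n → ℝ) → ℝ} (hp : Measurable p) (hp0 : ∀ y, 0 ≤ p y) (M : Kernel (Fin n → ℝ) Y)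
    [IsMarkovKernel M] (K : Finset (Fin n)) (i : Fin n) (xK : {j // j ∈ K} → ℝ) (x : ℝ) :
    IsFiniteMeasure (condOutput p M K i xK x) := by
  refine ⟨?_⟩
  rw [condOutput_apply hp M K i xK x MeasurableSet.univ]
  simpa using (lintegral_condDensity_le_one hp0 K i xK x).trans_lt ENNReal.one_lt_top

theorem database_add_smul {n : ℕ} (K : Finset (Fin n)) (i : Fin n) (hi : i ∉ K)
    (xK : {j // j ∈ K} → ℝ) (x x' : ℝ) {w : Fin n → ℝ} (hwi : w i = 1) (hwK : ∀ j ∈ K, w j = 0)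
    (u : {j // j ≠ i ∧ j ∉ K} → ℝ) :
    database K i xK x' (u + fun j : {j // j ≠ i ∧ j ∉ K} => (x' - x) * w j) =
      database K i xK x u + (x' - x) • w := by
  funext j
  by_cases hji : j = i
  · subst hji; simp [database, hwi]
  · by_cases hjK : j ∈ K
    · simp [database, hji, hjK, hwK j hjK]
    · simp [database, hji, hjK]

/-- If moving the target record and dragging the unknown records along the direction `w` changes
the joint density only by a factor that does not depend on the unknown records, then the
conditional output laws at `x` and `x'` are coupled by a deterministic displacement, and privacy
of the mechanism bounds their ratio by the `ℓ₁`-length of that displacement. -/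
theorem condOutput_le_of_shift {n : ℕ} {Y : Type*} [MeasurableSpace Y] {p : (Fin n → ℝ) → ℝ}
    (hp : Measurable p) {M : Kernel (Fin n → ℝ) Y} {ε : ℝ}
    (hM : IsMetricPrivate (fun D D' => ε * l1Dist D D') M)
    {K : Finset (Fin n)} {i : Fin n} (hi : i ∉ K) {xK : {j // j ∈ K} → ℝ} {x x' : ℝ}
    {w : Fin n → ℝ} (hwi : w i = 1) (hwK : ∀ j ∈ K, w j = 0) {c : ℝ} (hc : c ≠ 0)
    (hshift : ∀ u, p (database K i xK x u + (x' - x) • w) = c * p (database K i xK x u))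
    {S : Set Y} (hS : MeasurableSet S) :
    condOutput p M K i xK x S ≤
      ENNReal.ofReal (Real.exp (ε * (|x' - x| * ∑ j, |w j|))) * condOutput p M K i xK x' S := by
  set b : {j // j ≠ i ∧ j ∉ K} → ℝ := fun j => (x' - x) * w j with hb
  have hdb : ∀ u, database K i xK x' (u + b) = database K i xK x u + (x' - x) • w :=
    database_add_smul K i hi xK x x' hwi hwK
  have hZ : ∫ v, p (database K i xK x' v) = c * ∫ v, p (database K i xK x v) := by
    rw [← integral_add_right_eq_self _ b, ← integral_const_mul]
    simp_rw [hdb, hshift]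
  have hcond : ∀ u, condDensity p K i xK x' (u + b) = condDensity p K i xK x u := by
    intro u
    rw [condDensity, condDensity, hZ, hdb, hshift, mul_div_mul_left _ _ hc]
  rw [condOutput_apply hp M K i xK x hS, condOutput_apply hp M K i xK x' hS,
    ← lintegral_add_right_eq_self (fun u => ENNReal.ofReal (condDensity p K i xK x' u) *
      M (database K i xK x' u) S) b,
    ← lintegral_const_mul' _ _ ENNReal.ofReal_ne_top]
  refine lintegral_mono fun u => ?_
  simp only [hcond]
  rw [mul_left_comm]
  gcongr
  have hdist : l1Dist (database K i xK x u) (database K i xK x' (u + b)) =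
      |x' - x| * ∑ j, |w j| := by
    simp [hdb, l1Dist, abs_mul, Finset.mul_sum]
  rw [← hdist]
  exact hM _ _ S hS

/-! ### Gaussian densities -/

theorem continuous_gaussianDensity {n : ℕ} (μ : Fin n → ℝ) (Sig : Matrix (Fin n) (Fin n) ℝ) :
    Continuous (gaussianDensity μ Sig) := by
  unfold gaussianDensity
  have h : Continuous fun x : Fin n → ℝ => (x - μ) ⬝ᵥ (Matrix.mulVec Sig⁻¹ (x - μ)) := by
    unfold Matrix.mulVec dotProduct
    fun_prop
  fun_prop

theorem gaussianDensity_pos {n : ℕ} (μ : Fin n → ℝ) {Sig : Matrix (Fin n) (Fin n) ℝ}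
    (hS : Sig.PosDef) (x : Fin n → ℝ) : 0 < gaussianDensity μ Sig x := by
  have := hS.det_pos
  unfold gaussianDensity
  positivity

theorem dotProduct_mulVec_comm_of_isSymm {n : ℕ} {Q : Matrix (Fin n) (Fin n) ℝ} (hQ : Q.IsSymm)
    (v w : Fin n → ℝ) : v ⬝ᵥ (Q.mulVec w) = w ⬝ᵥ (Q.mulVec v) := by
  rw [Matrix.dotProduct_mulVec, ← Matrix.mulVec_transpose, hQ.eq, dotProduct_comm]

theorem isSymm_of_posDef {n : ℕ} {Sig : Matrix (Fin n) (Fin n) ℝ} (hS : Sig.PosDef) :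
    Sig.IsSymm := by
  simpa [Matrix.IsHermitian, Matrix.IsSymm, Matrix.conjTranspose_eq_transpose_of_trivial]
    using hS.isHermitian

/-- Translating a Gaussian density by `Σ z` multiplies it by an exponential that depends on the
point only through `z ⬝ᵥ (y - μ)`, hence only through the coordinates in the support of `z`. -/
theorem gaussianDensity_add_mulVec {n : ℕ} (μ : Fin n → ℝ) {Sig : Matrix (Fin n) (Fin n) ℝ}
    (hS : Sig.PosDef) (z y : Fin n → ℝ) (δ : ℝ) :
    gaussianDensity μ Sig (y + δ • Sig.mulVec z) =
      Real.exp (-(δ * (z ⬝ᵥ (y - μ)) + δ ^ 2 / 2 * (z ⬝ᵥ Sig.mulVec z))) *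
        gaussianDensity μ Sig y := by
  have hdet : IsUnit Sig.det := hS.det_pos.ne'.isUnit
  have hinv : Sig⁻¹.mulVec (Sig.mulVec z) = z := by
    rw [Matrix.mulVec_mulVec, Matrix.nonsing_inv_mul _ hdet, Matrix.one_mulVec]
  have hcross : (Sig.mulVec z) ⬝ᵥ Sig⁻¹.mulVec (y - μ) = z ⬝ᵥ (y - μ) := by
    rw [dotProduct_mulVec_comm_of_isSymm (isSymm_of_posDef hS.inv), hinv, dotProduct_comm]
  unfold gaussianDensity
  rw [mul_left_comm, ← Real.exp_add]
  congr 2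
  rw [show y + δ • Sig.mulVec z - μ = (y - μ) + δ • Sig.mulVec z by abel]
  simp only [Matrix.mulVec_add, Matrix.mulVec_smul, hinv, add_dotProduct, dotProduct_add,
    smul_dotProduct, dotProduct_smul, smul_eq_mul, hcross]
  rw [dotProduct_comm (y - μ) z, dotProduct_comm (Sig.mulVec z) z]
  ring

/-! ### Independent blocks of a Gaussian vector -/

/-- Averages of a continuous function over shrinking balls converge to its value at the centre. -/
theorem tendsto_setLIntegral_closedBall_div {n : ℕ} {f : (Fin n → ℝ) → ENNReal}
    (hf : Continuous f) (y : Fin n → ℝ) :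
    Tendsto (fun r : ℝ => (∫⁻ v in Metric.closedBall y r, f v) /
      ENNReal.ofReal ((2 * r) ^ n)) (𝓝[>] 0) (𝓝 (f y)) := by
  have hV : ∀ r : ℝ, 0 < r → volume (Metric.closedBall y r) = ENNReal.ofReal ((2 * r) ^ n) := by
    intro r hr
    rw [Real.volume_pi_closedBall _ hr.le, Fintype.card_fin]
  have hV0 : ∀ r : ℝ, 0 < r → ENNReal.ofReal ((2 * r) ^ n) ≠ 0 := by
    intro r hr
    simpa using by positivity
  have hball : ∀ {q : (Fin n → ℝ) → Prop}, (∀ᶠ v in 𝓝 y, q v) →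
      ∀ᶠ r in 𝓝[>] (0 : ℝ), 0 < r ∧ ∀ v ∈ Metric.closedBall y r, q v := by
    intro q hq
    obtain ⟨η, hη, h⟩ := Metric.nhds_basis_closedBall.eventually_iff.1 hq
    filter_upwards [Ioc_mem_nhdsGT hη] with r hr
    exact ⟨hr.1, fun v hv => h (Metric.closedBall_subset_closedBall hr.2 hv)⟩
  refine tendsto_of_le_liminf_of_limsup_le ?_ ?_
  · refine le_of_forall_lt fun a ha => ?_
    obtain ⟨a', haa', ha'⟩ := exists_between ha
    refine haa'.trans_le (le_liminf_of_le (by isBoundedDefault) ?_)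
    filter_upwards [hball (hf.continuousAt.eventually_const_lt ha')] with r hr
    rw [ENNReal.le_div_iff_mul_le (Or.inl (hV0 r hr.1)) (Or.inl ENNReal.ofReal_ne_top),
      ← hV r hr.1, ← setLIntegral_const]
    exact setLIntegral_mono' Metric.isClosed_closedBall.measurableSet fun v hv => (hr.2 v hv).le
  · refine le_of_forall_gt fun a ha => ?_
    obtain ⟨a', ha', haa'⟩ := exists_between ha
    refine (limsup_le_of_le (by isBoundedDefault) ?_).trans_lt haa'
    filter_upwards [hball (hf.continuousAt.eventually_lt_const ha')] with r hr
    refine ENNReal.div_le_of_le_mul ?_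
    rw [← hV r hr.1, ← setLIntegral_const]
    exact setLIntegral_mono' Metric.isClosed_closedBall.measurableSet fun v hv => (hr.2 v hv).le

/-- A continuous density of a vector whose blocks `C` and `Cᶜ` are independent satisfies the
exchange identity of a product density, where `C.piecewise y y'` has the coordinates of `y` on `C`
and those of `y'` elsewhere. Comparing probabilities of four boxes avoids any use of marginal
densities or of the total mass. -/
theorem mul_eq_mul_piecewise_of_indepFun {n : ℕ} {p : (Fin n → ℝ) → ℝ} (hp : Continuous p)
    (hp0 : ∀ y, 0 ≤ p y) {C : Finset (Fin n)}
    (hind : IndepFun (fun (x : Fin n → ℝ) (j : {j // j ∈ C}) => x j)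
        (fun (x : Fin n → ℝ) (j : {j // j ∉ C}) => x j) (lawOfDensity p))
    (y y' : Fin n → ℝ) :
    p y * p y' = p (C.piecewise y y') * p (C.piecewise y' y) := by
  set P := lawOfDensity p with hP
  have hbox : ∀ (a : Fin n → ℝ) (r : ℝ), 0 < r →
      Metric.closedBall a r = (fun (x : Fin n → ℝ) (j : {j // j ∈ C}) => x j) ⁻¹'
          (Metric.closedBall (fun j => a j) r) ∩
        (fun (x : Fin n → ℝ) (j : {j // j ∉ C}) => x j) ⁻¹'
          (Metric.closedBall (fun j => a j) r) := by
    intro a r hr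
    ext v
    simp only [Metric.mem_closedBall, dist_pi_le_iff hr.le, Set.mem_inter_iff, Set.mem_preimage,
      Subtype.forall]
    exact ⟨fun h => ⟨fun j _ => h j, fun j _ => h j⟩,
      fun h j => (em (j ∈ C)).elim (h.1 j) (h.2 j)⟩
  have hprod : ∀ (a : Fin n → ℝ) (r : ℝ), 0 < r → P (Metric.closedBall a r) =
      P ((fun (x : Fin n → ℝ) (j : {j // j ∈ C}) => x j) ⁻¹'
          (Metric.closedBall (fun j => a j) r)) *
      P ((fun (x : Fin n → ℝ) (j : {j // j ∉ C}) => x j) ⁻¹'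
          (Metric.closedBall (fun j => a j) r)) := by
    intro a r hr
    rw [hbox a r hr]
    exact hind.measure_inter_preimage_eq_mul _ _ Metric.isClosed_closedBall.measurableSet
      Metric.isClosed_closedBall.measurableSet
  have hexch : ∀ r : ℝ, 0 < r → P (Metric.closedBall y r) * P (Metric.closedBall y' r) =
      P (Metric.closedBall (C.piecewise y y') r) * P (Metric.closedBall (C.piecewise y' y) r) := by
    intro r hr
    have e₁ : ∀ a b : Fin n → ℝ,
        (fun j : {j // j ∈ C} => C.piecewise a b j) = fun j : {j // j ∈ C} => a j := by
      intro a b; funext j; simp [j.2]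
    have e₂ : ∀ a b : Fin n → ℝ,
        (fun j : {j // j ∉ C} => C.piecewise a b j) = fun j : {j // j ∉ C} => b j := by
      intro a b; funext j; simp [j.2]
    rw [hprod y r hr, hprod y' r hr, hprod (C.piecewise y y') r hr, hprod (C.piecewise y' y) r hr,
      e₁, e₁, e₂, e₂]
    ring
  have hcont : Continuous fun v => ENNReal.ofReal (p v) := ENNReal.continuous_ofReal.comp hp
  have hlim : ∀ a, Tendsto (fun r : ℝ => P (Metric.closedBall a r) /
      ENNReal.ofReal ((2 * r) ^ n)) (𝓝[>] 0) (𝓝 (ENNReal.ofReal (p a))) := by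
    intro a
    refine (tendsto_setLIntegral_closedBall_div hcont a).congr fun r => ?_
    rw [hP, lawOfDensity, withDensity_apply _ Metric.isClosed_closedBall.measurableSet]
  have hmul : ∀ a b, Tendsto (fun r : ℝ =>
      P (Metric.closedBall a r) * P (Metric.closedBall b r) *
        ((ENNReal.ofReal ((2 * r) ^ n))⁻¹ * (ENNReal.ofReal ((2 * r) ^ n))⁻¹)) (𝓝[>] 0)
      (𝓝 (ENNReal.ofReal (p a * p b))) := by
    intro a b
    rw [ENNReal.ofReal_mul (hp0 a)]
    refine (ENNReal.Tendsto.mul (hlim a) (Or.inr ENNReal.ofReal_ne_top) (hlim b)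
      (Or.inr ENNReal.ofReal_ne_top)).congr fun r => ?_
    simp only [div_eq_mul_inv]
    ring
  have hlim_eq := tendsto_nhds_unique (hmul y y')
    ((hmul (C.piecewise y y') (C.piecewise y' y)).congr' <| by
      filter_upwards [self_mem_nhdsWithin] with r hr
      rw [hexch r hr])
  exact (ENNReal.ofReal_eq_ofReal_iff (mul_nonneg (hp0 _) (hp0 _))
    (mul_nonneg (hp0 _) (hp0 _))).1 hlim_eq

/-- A positive definite matrix whose inverse has no entries linking `C` to `Cᶜ` has none itself. -/
theorem apply_eq_zero_of_inv_apply_eq_zero {n : ℕ} {Sig : Matrix (Fin n) (Fin n) ℝ}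
    (hS : Sig.PosDef) {C : Finset (Fin n)} (h : ∀ s ∈ C, ∀ j ∉ C, Sig⁻¹ j s = 0)
    {t j : Fin n} (ht : t ∈ C) (hj : j ∉ C) : Sig j t = 0 := by
  -- `v` is the part of the column `Sig.col t` outside `C`; its `Sig⁻¹`-energy vanishes.
  set v : Fin n → ℝ := fun k => if k ∈ C then 0 else Sig k t with hv
  have hQ : ∀ k, k ∉ C → (Sig⁻¹.mulVec v) k = 0 := by
    intro k hk
    have hkt : k ≠ t := fun e => hk (e ▸ ht)
    have h1 : (Sig⁻¹ * Sig) k t = 0 := by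
      rw [Matrix.nonsing_inv_mul _ hS.det_pos.ne'.isUnit, Matrix.one_apply_ne hkt]
    rw [Matrix.mul_apply] at h1
    rw [← h1, Matrix.mulVec, dotProduct]
    refine Finset.sum_congr rfl fun s _ => ?_
    by_cases hs : s ∈ C
    · simp [h s hs k hk]
    · simp [hv, hs]
  have hv0 : v = 0 := by
    by_contra hne
    have hpos := hS.inv.dotProduct_mulVec_pos hne
    refine hpos.ne' (Finset.sum_eq_zero fun k _ => ?_)
    by_cases hk : k ∈ C
    · simp [hv, hk]
    · simp [hQ k hk]
  simpa [hv, hj] using congrFun hv0 j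

/-- Independence of the blocks `C` and `Cᶜ` of a Gaussian vector forces the covariances between
them to vanish. The exchange identity at `μ + e_s + e_j` and `μ` kills the entry `(j, s)` of the
precision matrix. -/
theorem covariance_eq_zero_of_indepFun {n : ℕ} {μ : Fin n → ℝ} {Sig : Matrix (Fin n) (Fin n) ℝ}
    (hS : Sig.PosDef) {C : Finset (Fin n)}
    (hind : IndepFun (fun (x : Fin n → ℝ) (j : {j // j ∈ C}) => x j)
        (fun (x : Fin n → ℝ) (j : {j // j ∉ C}) => x j)
        (lawOfDensity (gaussianDensity μ Sig)))
    {t j : Fin n} (ht : t ∈ C) (hj : j ∉ C) : Sig j t = 0 := by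
  refine apply_eq_zero_of_inv_apply_eq_zero hS (fun s hs j hj => ?_) ht hj
  have h := mul_eq_mul_piecewise_of_indepFun (continuous_gaussianDensity μ Sig)
    (fun y => (gaussianDensity_pos μ hS y).le) hind (μ + (Pi.single s 1 + Pi.single j 1)) μ
  have e₁ : C.piecewise (μ + (Pi.single s 1 + Pi.single j 1)) μ = μ + Pi.single s 1 := by
    funext k
    by_cases hk : k ∈ C
    · have : k ≠ j := fun e => hj (e ▸ hk)
      simp [hk, this]
    · have : k ≠ s := fun e => hk (e ▸ hs)
      simp [hk, this]
  have e₂ : C.piecewise μ (μ + (Pi.single s 1 + Pi.single j 1)) = μ + Pi.single j 1 := by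
    funext k
    by_cases hk : k ∈ C
    · have : k ≠ j := fun e => hj (e ▸ hk)
      simp [hk, this]
    · have : k ≠ s := fun e => hk (e ▸ hs)
      simp [hk, this]
  have hsymm : Sig⁻¹ s j = Sig⁻¹ j s := (isSymm_of_posDef hS.inv).apply _ _
  have hc : (0 : ℝ) < 1 / Real.sqrt ((2 * Real.pi) ^ n * Sig.det) := by
    have := hS.det_pos
    positivity
  rw [e₁, e₂] at h
  simp only [gaussianDensity, add_sub_cancel_left, sub_self] at h
  simp only [mul_mul_mul_comm _ (Real.exp _)] at h
  have h' := mul_left_cancel₀ (mul_pos hc hc).ne' h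
  rw [← Real.exp_add, ← Real.exp_add, Real.exp_eq_exp] at h'
  simp only [Matrix.mulVec_add, add_dotProduct, dotProduct_add, Matrix.mulVec_single_one,
    single_one_dotProduct, Matrix.col_apply, zero_dotProduct] at h'
  linarith

/-! ### Size of the regression coefficients -/

/-- Invertibility of the principal block `Σ_TT`: some `z` supported on `T` has `Σ_TT z = e_i`. -/
theorem exists_mulVec_eq_single {n : ℕ} {Sig : Matrix (Fin n) (Fin n) ℝ} (hS : Sig.PosDef)
    {T : Finset (Fin n)} {i : Fin n} (hi : i ∈ T) :
    ∃ z : Fin n → ℝ, (∀ j ∉ T, z j = 0) ∧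
      ∀ j ∈ T, Sig.mulVec z j = if j = i then 1 else 0 := by
  classical
  set A := Sig.submatrix (Subtype.val : T → Fin n) Subtype.val with hA
  have hAdet : IsUnit A.det := (hS.submatrix Subtype.val_injective).det_pos.ne'.isUnit
  set z' : T → ℝ := A⁻¹.mulVec (Pi.single ⟨i, hi⟩ 1) with hz'
  refine ⟨fun j => if h : j ∈ T then z' ⟨j, h⟩ else 0, fun j hj => by simp [hj], fun j hj => ?_⟩
  have h1 : A.mulVec z' ⟨j, hj⟩ = if j = i then 1 else 0 := by
    rw [hz', Matrix.mulVec_mulVec, Matrix.mul_nonsing_inv _ hAdet, Matrix.one_mulVec,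
      Pi.single_apply]
    simp
  rw [← h1, Matrix.mulVec, Matrix.mulVec, dotProduct, dotProduct]
  rw [← Finset.sum_subset (Finset.subset_univ T) (fun k _ hk => by simp [hk]),
    ← Finset.sum_coe_sort]
  exact Finset.sum_congr rfl fun k _ => by simp [hA]

/-- A column `z` of the inverse of the principal block `Σ_TT` has small `ℓ₁`-norm: the block is
strictly diagonally dominant when `ρ (|T| - 1) < 1`. -/
theorem sum_abs_mul_le_one {n : ℕ} {Sig : Matrix (Fin n) (Fin n) ℝ} {ρ σ2 : ℝ}
    (hσ : 0 < σ2) (hdiag : ∀ i, Sig i i = σ2) (hoff : ∀ i j, i ≠ j → |Sig i j| ≤ ρ * σ2)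
    {T : Finset (Fin n)} {i : Fin n} (hi : i ∈ T) {z : Fin n → ℝ} (hzT : ∀ j ∉ T, z j = 0)
    (hz : ∀ j ∈ T, Sig.mulVec z j = if j = i then 1 else 0) :
    σ2 * (∑ j, |z j|) * (1 - ρ * (T.card - 1)) ≤ 1 := by
  have hN : ∑ j ∈ T, |z j| = ∑ j, |z j| :=
    Finset.sum_subset (Finset.subset_univ T) fun k _ hk => by simp [hzT k hk]
  have hrow : ∀ t ∈ T, σ2 * |z t| ≤
      (if t = i then 1 else 0) + ρ * σ2 * (∑ j, |z j| - |z t|) := by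
    intro t ht
    have h1 := hz t ht
    rw [Matrix.mulVec, dotProduct, ← Finset.add_sum_erase _ _ (Finset.mem_univ t), hdiag] at h1
    have h2 : |∑ k ∈ Finset.univ.erase t, Sig t k * z k| ≤ ρ * σ2 * (∑ j, |z j| - |z t|) := by
      rw [← Finset.add_sum_erase _ (fun j => |z j|) (Finset.mem_univ t), add_sub_cancel_left,
        Finset.mul_sum]
      refine (Finset.abs_sum_le_sum_abs _ _).trans (Finset.sum_le_sum fun k hk => ?_)
      rw [abs_mul]
      exact mul_le_mul_of_nonneg_right (hoff t k (Finset.ne_of_mem_erase hk).symm) (abs_nonneg _)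
    have h3 : σ2 * |z t| = |(if t = i then (1 : ℝ) else 0) -
        ∑ k ∈ Finset.univ.erase t, Sig t k * z k| := by
      rw [← h1, add_sub_cancel_right, abs_mul, abs_of_pos hσ]
    rw [h3]
    refine (abs_sub _ _).trans (add_le_add (le_of_eq ?_) h2)
    split_ifs <;> simp
  have hsum := Finset.sum_le_sum hrow
  rw [← Finset.mul_sum, hN, Finset.sum_add_distrib, ← Finset.mul_sum, Finset.sum_sub_distrib, hN,
    Finset.sum_ite_eq' T i, if_pos hi, Finset.sum_const, nsmul_eq_mul] at hsum
  linarith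

/-- With `T` the known records and the target inside a block `C` of correlated records, `Σ z` is
the displacement of the conditional mean of all records per unit displacement of the target. Its
entries off `T` are at most `ρ / (1 - ρ (|T| - 1))`, and there are at most `m - 1 ≤ m² / 4` of them
inside `C`. -/
theorem sum_abs_mulVec_le {n : ℕ} {Sig : Matrix (Fin n) (Fin n) ℝ} {ρ σ2 : ℝ} (hρ : 0 ≤ ρ)
    (hσ : 0 < σ2) (hdiag : ∀ i, Sig i i = σ2) (hoff : ∀ i j, i ≠ j → |Sig i j| ≤ ρ * σ2)
    {C T : Finset (Fin n)} (hTC : T ⊆ C) {m : ℕ} (hC : C.card ≤ m) (hρm : ρ * ((m : ℝ) - 2) < 1)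
    {i : Fin n} (hi : i ∈ T) {z : Fin n → ℝ} (hzT : ∀ j ∉ T, z j = 0)
    (hz : ∀ j ∈ T, Sig.mulVec z j = if j = i then 1 else 0)
    (hzC : ∀ j ∉ C, Sig.mulVec z j = 0) :
    ∑ j, |Sig.mulVec z j| ≤ (m : ℝ) ^ 2 * ρ / (4 * (1 - ρ * ((m : ℝ) - 2))) + 1 := by
  set B := σ2 * ∑ j, |z j| with hB
  have hB0 : 0 ≤ B := mul_nonneg hσ.le (Finset.sum_nonneg fun _ _ => abs_nonneg _)
  have hd : 0 < 1 - ρ * ((m : ℝ) - 2) := by linarith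
  have hentry : ∀ j, |Sig.mulVec z j| ≤
      (if j = i then 1 else 0) + if j ∈ C \ T then ρ * B else 0 := by
    intro j
    by_cases hjT : j ∈ T
    · rw [hz j hjT]
      split_ifs <;> simp_all
    · have hji : j ≠ i := fun e => hjT (e ▸ hi)
      by_cases hjC : j ∈ C
      · rw [if_neg hji, if_pos (Finset.mem_sdiff.2 ⟨hjC, hjT⟩), zero_add, hB, ← mul_assoc,
          Finset.mul_sum]
        rw [Matrix.mulVec, dotProduct]
        refine (Finset.abs_sum_le_sum_abs _ _).trans (Finset.sum_le_sum fun k _ => ?_)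
        rw [abs_mul]
        by_cases hjk : j = k
        · simp [← hjk, hzT j hjT]
        · exact mul_le_mul_of_nonneg_right (hoff j k hjk) (abs_nonneg _)
      · simp [hzC j hjC, hjC, hji]
  have hsum := Finset.sum_le_sum fun j (_ : j ∈ Finset.univ) => hentry j
  rw [Finset.sum_add_distrib, Finset.sum_ite_eq' Finset.univ i, if_pos (Finset.mem_univ i),
    Finset.sum_ite_mem, Finset.univ_inter, Finset.sum_const, nsmul_eq_mul] at hsum
  refine hsum.trans ?_
  rw [add_comm]
  gcongr
  rw [le_div_iff₀ (by positivity)]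
  have hT : 1 ≤ T.card := Finset.card_pos.2 ⟨i, hi⟩
  have hcard : (C \ T).card + T.card ≤ m := by
    rw [Finset.card_sdiff_add_card_eq_card hTC]; exact hC
  rcases Nat.eq_zero_or_pos (C \ T).card with h0 | h0
  · rw [h0]; push_cast; rw [zero_mul, zero_mul]; positivity
  · have hTm : (T.card : ℝ) - 1 ≤ m - 2 := by
      have : (T.card : ℝ) + 1 ≤ m := by exact_mod_cast (by omega : T.card + 1 ≤ m)
      linarith
    have hu : ((C \ T).card : ℝ) ≤ m - 1 := by
      have : ((C \ T).card : ℝ) + 1 ≤ m := by exact_mod_cast (by omega : (C \ T).card + 1 ≤ m)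
      linarith
    have hB1 : B * (1 - ρ * ((m : ℝ) - 2)) ≤ 1 := by
      refine le_trans ?_ (sum_abs_mul_le_one hσ hdiag hoff hi hzT hz)
      gcongr
    have hu4 : 4 * ((C \ T).card : ℝ) ≤ (m : ℝ) ^ 2 := by
      nlinarith [sq_nonneg ((m : ℝ) - 2)]
    calc ((C \ T).card : ℝ) * (ρ * B) * (4 * (1 - ρ * ((m : ℝ) - 2)))
        = (4 * ((C \ T).card : ℝ)) * ρ * (B * (1 - ρ * ((m : ℝ) - 2))) := by ring
      _ ≤ (m : ℝ) ^ 2 * ρ * 1 := by gcongr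
      _ = (m : ℝ) ^ 2 * ρ := mul_one _

/-! ### The leakage bound -/

/-- The bound in a form that stays meaningful at `ρ = 0`: the fraction `m² / (4 (1 / ρ - m + 2))` has
been expanded by `ρ`. -/
theorem targetLeakage_gaussian_le {n : ℕ} {Y : Type*} [MeasurableSpace Y]
    (M : Kernel (Fin n → ℝ) Y) [IsMarkovKernel M] {ε : ℝ} (hε : 0 < ε)
    (hM : IsMetricPrivate (fun D D' => ε * l1Dist D D') M)
    (μ : Fin n → ℝ) {Sig : Matrix (Fin n) (Fin n) ℝ} {ρ : ℝ} (hρ : 0 ≤ ρ)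
    (hSig : IsLimitedCovariance ρ Sig) {m : ℕ}
    (hm : HasAtMostCorrelated (lawOfDensity (gaussianDensity μ Sig)) m)
    (hρm : ρ * ((m : ℝ) - 2) < 1) (x x' : ℝ) :
    targetLeakage (gaussianDensity μ Sig) M x x' ≤
      ((((m : ℝ) ^ 2 * ρ / (4 * (1 - ρ * ((m : ℝ) - 2))) + 1) * ε * |x' - x| : ℝ) : EReal) := by
  obtain ⟨r, C, -, hcover, hC⟩ := hm
  obtain ⟨hS, σ2, hσ, hdiag, hoff⟩ := hSig
  have hmeas := (continuous_gaussianDensity μ Sig).measurable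
  have hnn : ∀ y, 0 ≤ gaussianDensity μ Sig y := fun y => (gaussianDensity_pos μ hS y).le
  refine iSup_le fun i => iSup_le fun K => iSup_le fun hiK => iSup_le fun xK => ?_
  obtain ⟨l, hil⟩ := hcover i
  set T := insert i K ∩ C l with hT
  have hiT : i ∈ T := Finset.mem_inter.2 ⟨Finset.mem_insert_self i K, hil⟩
  obtain ⟨z, hzT, hz⟩ := exists_mulVec_eq_single hS hiT
  have hzC : ∀ j ∉ C l, Sig.mulVec z j = 0 := by
    intro j hj
    rw [Matrix.mulVec, dotProduct]
    refine Finset.sum_eq_zero fun k _ => ?_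
    by_cases hk : k ∈ C l
    · rw [covariance_eq_zero_of_indepFun hS (hC l).2 hk hj, zero_mul]
    · rw [hzT k fun h => hk (Finset.mem_inter.1 h).2, mul_zero]
  have hw := sum_abs_mulVec_le hρ hσ hdiag hoff Finset.inter_subset_right (hC l).1 hρm hiT hzT hz
    hzC
  have hwK : ∀ j ∈ K, Sig.mulVec z j = 0 := by
    intro j hj
    by_cases hjC : j ∈ C l
    · rw [hz j (Finset.mem_inter.2 ⟨Finset.mem_insert_of_mem hj, hjC⟩),
        if_neg fun e : j = i => hiK (e ▸ hj)]
    · exact hzC j hjC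
  have hwi : Sig.mulVec z i = 1 := by rw [hz i hiT, if_pos rfl]
  -- `z` is supported on the target and known records, so this product ignores the unknown ones.
  have hdot : ∀ u, z ⬝ᵥ (database K i xK x u - μ) = z ⬝ᵥ (database K i xK x 0 - μ) := by
    refine fun u => Finset.sum_congr rfl fun j _ => ?_
    by_cases hj : j ∈ T
    · rcases Finset.mem_insert.1 (Finset.mem_inter.1 hj).1 with rfl | hjK
      · simp [database]
      · simp [database, hjK]
    · rw [hzT j hj, zero_mul, zero_mul]
  have hfin₁ := isFiniteMeasure_condOutput hmeas hnn M K i xK x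
  have hfin₂ := isFiniteMeasure_condOutput hmeas hnn M K i xK x'
  refine (maxLogRatio_le_of_le_smul fun A hA =>
    condOutput_le_of_shift hmeas hM hiK hwi hwK
      (c := Real.exp (-((x' - x) * (z ⬝ᵥ (database K i xK x 0 - μ)) +
        (x' - x) ^ 2 / 2 * (z ⬝ᵥ Sig.mulVec z))))
      (Real.exp_pos _).ne' (fun u => ?_) hA).trans ?_
  · rw [gaussianDensity_add_mulVec μ hS, hdot]
  · refine EReal.coe_le_coe_iff.2 ?_
    rw [mul_comm (|x' - x|), mul_left_comm, ← mul_assoc]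
    gcongr

end BayesianPrivacy

theorem mainTheorem4 {n : ℕ} {Y : Type*} [MeasurableSpace Y]
    (M : ProbabilityTheory.Kernel (Fin n → ℝ) Y) [ProbabilityTheory.IsMarkovKernel M]
    (ε : ℝ) (hε : 0 < ε)
    (hM : BayesianPrivacy.IsMetricPrivate (fun D D' => ε * BayesianPrivacy.l1Dist D D') M)
    (μ : Fin n → ℝ) (Sig : Matrix (Fin n) (Fin n) ℝ) (ρ : ℝ) (hρ0 : 0 ≤ ρ) (hρ1 : ρ ≤ 1)
    (hSig : BayesianPrivacy.IsLimitedCovariance ρ Sig)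
    (m : ℕ) (hmn : m ≤ n)
    (hm : BayesianPrivacy.HasAtMostCorrelated
      (BayesianPrivacy.lawOfDensity (BayesianPrivacy.gaussianDensity μ Sig)) m)
    (hρm : ρ * ((m : ℝ) - 2) < 1) (x x' : ℝ) :
    (0 < ρ →
      BayesianPrivacy.targetLeakage (BayesianPrivacy.gaussianDensity μ Sig) M x x' ≤
        (((((m : ℝ) ^ 2 / (4 * (1 / ρ - (m : ℝ) + 2)) + 1) * ε * |x' - x| : ℝ)) : EReal)) ∧
    (ρ = 0 →
      BayesianPrivacy.targetLeakage (BayesianPrivacy.gaussianDensity μ Sig) M x x' ≤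
        ((ε * |x' - x| : ℝ) : EReal)) := by
  have h := BayesianPrivacy.targetLeakage_gaussian_le M hε hM μ hρ0 hSig hm hρm x x'
  refine ⟨fun hρ => ?_, fun hρ => ?_⟩
  · have e : (m : ℝ) ^ 2 / (4 * (1 / ρ - (m : ℝ) + 2)) =
        (m : ℝ) ^ 2 * ρ / (4 * (1 - ρ * ((m : ℝ) - 2))) := by
      rw [← mul_div_mul_right _ (4 * (1 / ρ - (m : ℝ) + 2)) hρ.ne']
      congr 1
      field_simp
      ring
    rw [e]
    exact h
  · simpa [hρ] using h
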